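/- Let $K$ be a field of characteristic $0$ and let $A_1$ be the first Weyl algebra over $K$, i.e. the associative unital $K$-algebra generated by $p,q$ subject to the relation $[p,q]=pq-qp=1$. The elements $p^iq^j$ $(i,j\ge 0)$ form a $K$-basis of $A_1$; let $\Phi:A_1\to K[X,Y]$ be the linear isomorphism with $\Phi(p^iq^j)=X^iY^j$. For $(\rho,\sigma)\in\mathbb R^2$ with $\rho+\sigma>0$ and $z\in A_1\setminus\{0\}$ with $\Phi(z)=\sum\alpha_{ij}X^iY^j$, put $\mathbf v_{\rho,\sigma}(z)=\sup\{\rho i+\sigma j\mid \alpha_{ij}\ne 0\}$ and $$\mathbf f_{\rho,\sigma}(z)=\sum_{\rho i+\sigma j=\mathbf v_{\rho,\sigma}(z)}\alpha_{ij}X^iY^j .$$ For $f,g\in K[X,Y]$ let $\{f,g\}=\frac{\partial f}{\partial X}\frac{\partial g}{\partial Y}-\frac{\partial f}{\partial Y}\frac{\partial g}{\partial X}$ and $C(f)=\{g\in K[X,Y]\mid \{f,g\}=0\}$, and let $K[f]$ be the $K$-subalgebra of $K[X,Y]$ generated by $f$. Let $z\in A_1\setminus\{0\}$ and let $f=\mathbf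 f_{\rho,\sigma}(z)$ for some $(\rho,\sigma)\in\mathbb R^2$ with $\rho+\sigma>0$. If $C(f)=K[f]$, then for every $w\in A_1$ with $[z,w]=zw-wz=1$, the elements $z$ and $w$ generate the $K$-algebra $A_1$. -/

import Mathlib

open MvPolynomial

/-- The relation `p q = q p + 1` on the free algebra on two letters, `p` being the letter `0`
and `q` the letter `1`. -/
inductive WeylRel (K : Type*) [Field K] : FreeAlgebra K (Fin 2) → FreeAlgebra K (Fin 2) → Prop
  | comm : WeylRel K (FreeAlgebra.ι K 0 * FreeAlgebra.ι K 1)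
      (FreeAlgebra.ι K 1 * FreeAlgebra.ι K 0 + 1)

/-- The first Weyl algebra `A₁` over `K`: the associative unital `K`-algebra generated by `p` and
`q` subject to the single relation `p q - q p = 1`. -/
abbrev WeylA1 (K : Type*) [Field K] : Type _ := RingQuot (WeylRel K)

namespace WeylA1

noncomputable section

variable {K : Type*} [Field K]

/-- The generator `p` of the Weyl algebra. -/
def p : WeylA1 K := RingQuot.mkAlgHom K (WeylRel K) (FreeAlgebra.ι K 0)

/-- The generator `q` of the Weyl algebra. -/
def q : WeylA1 K := RingQuot.mkAlgHom K (WeylRel K) (FreeAlgebra.ι K 1)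

theorem p_mul_q : (p * q : WeylA1 K) = q * p + 1 := by
  have h := RingQuot.mkAlgHom_rel K (WeylRel.comm (K := K))
  rw [map_mul, map_add, map_mul, map_one] at h
  exact h

/-- The linear map `K[X,Y] → A₁`, `∑ αᵢⱼ XⁱYʲ ↦ ∑ αᵢⱼ pⁱqʲ`, where `X` is the variable `0` and
`Y` is the variable `1`. -/
def ofPoly : MvPolynomial (Fin 2) K →ₗ[K] WeylA1 K :=
  (MvPolynomial.basisMonomials (Fin 2) K).constr K (fun m => p ^ m 0 * q ^ m 1)

theorem ofPoly_monomial (m : Fin 2 →₀ ℕ) :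
    ofPoly (monomial m (1 : K)) = p ^ m 0 * q ^ m 1 := by
  have h := (MvPolynomial.basisMonomials (Fin 2) K).constr_basis K
    (fun m => (p ^ m 0 * q ^ m 1 : WeylA1 K)) m
  rw [MvPolynomial.coe_basisMonomials] at h
  exact h

/-- The operator `X` on `K[X,Y]`, by which `p` acts. -/
def opP : Module.End K (MvPolynomial (Fin 2) K) := LinearMap.mulLeft K (X 0)

/-- The operator `Y - ∂/∂X` on `K[X,Y]`, by which `q` acts. -/
def opQ : Module.End K (MvPolynomial (Fin 2) K) :=
  LinearMap.mulLeft K (X 1) - (pderiv (0 : Fin 2)).toLinearMap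

theorem opP_apply (f : MvPolynomial (Fin 2) K) : opP f = X 0 * f := rfl

theorem opQ_apply (f : MvPolynomial (Fin 2) K) : opQ f = X 1 * f - pderiv 0 f := rfl

/-- The action of `A₁` on `K[X,Y]` in which `p` acts as `X` and `q` acts as `Y - ∂/∂X`. It sends
`1` under `pⁱqʲ` to `XⁱYʲ`, which shows that the `pⁱqʲ` are a basis of `A₁`. -/
def act : WeylA1 K →ₐ[K] Module.End K (MvPolynomial (Fin 2) K) :=
  RingQuot.liftAlgHom K ⟨FreeAlgebra.lift K ![opP, opQ], by
    rintro _ _ ⟨⟩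
    ext1 m
    refine LinearMap.ext fun c => ?_
    simp only [map_mul, map_add, map_one, FreeAlgebra.lift_ι_apply, Matrix.cons_val_zero,
      Matrix.cons_val_one, LinearMap.comp_apply, Module.End.mul_apply, LinearMap.add_apply,
      Module.End.one_apply, opP_apply, opQ_apply, Derivation.leibniz, pderiv_X_self, smul_eq_mul]
    ring⟩

theorem act_p : act (p : WeylA1 K) = opP := by
  simp [act, p]

theorem act_q : act (q : WeylA1 K) = opQ := by
  simp [act, q]

theorem opQ_pow (j : ℕ) : (opQ ^ j) (1 : MvPolynomial (Fin 2) K) = X 1 ^ j := by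
  induction j with
  | zero => simp
  | succ j ih =>
    rw [pow_succ', Module.End.mul_apply, ih, opQ_apply, Derivation.leibniz_pow,
      pderiv_X_of_ne (by decide)]
    simp [pow_succ']

theorem opP_pow (i : ℕ) (f : MvPolynomial (Fin 2) K) : (opP ^ i) f = X 0 ^ i * f := by
  induction i with
  | zero => simp
  | succ i ih => rw [pow_succ', Module.End.mul_apply, ih, opP_apply, pow_succ', mul_assoc]

theorem act_ofPoly (f : MvPolynomial (Fin 2) K) : act (ofPoly f) 1 = f := by
  suffices h : (LinearMap.applyₗ (1 : MvPolynomial (Fin 2) K)).comp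
      (act.toLinearMap.comp ofPoly) = LinearMap.id from LinearMap.congr_fun h f
  refine (MvPolynomial.basisMonomials (Fin 2) K).ext fun m => ?_
  simp only [MvPolynomial.coe_basisMonomials, LinearMap.comp_apply, AlgHom.toLinearMap_apply,
    LinearMap.applyₗ_apply_apply, LinearMap.id_apply, ofPoly_monomial, map_mul, map_pow, act_p,
    act_q, Module.End.mul_apply, opQ_pow, opP_pow]
  rw [MvPolynomial.monomial_eq, Finsupp.prod_fintype _ _ (by simp)]
  simp

theorem q_mul_p_pow (i : ℕ) :
    (q * p ^ i : WeylA1 K) = p ^ i * q - (i : K) • p ^ (i - 1) := by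
  induction i with
  | zero => simp
  | succ i ih =>
    have h1 : (q * p : WeylA1 K) = p * q - 1 := by rw [p_mul_q]; simp
    rw [pow_succ', ← mul_assoc, h1, sub_mul, mul_assoc, ih, one_mul, mul_sub, ← mul_assoc]
    rcases i with _ | i
    · simp
    · rw [Nat.add_sub_cancel, Nat.add_sub_cancel, mul_smul_comm, ← pow_succ', Nat.cast_succ (i + 1),
        add_smul, one_smul, sub_sub,
        ← pow_succ' p i]

theorem ofPoly_opP (f : MvPolynomial (Fin 2) K) : ofPoly (opP f) = p * ofPoly f := by
  suffices h : ofPoly.comp opP = (LinearMap.mulLeft K (p : WeylA1 K)).comp ofPoly from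
    LinearMap.congr_fun h f
  refine (MvPolynomial.basisMonomials (Fin 2) K).ext fun m => ?_
  have h : (X 0 * monomial m 1 : MvPolynomial (Fin 2) K)
      = monomial (Finsupp.single 0 1 + m) 1 := by
    rw [X, monomial_mul, one_mul]
  simp only [MvPolynomial.coe_basisMonomials, LinearMap.comp_apply, opP_apply, h, ofPoly_monomial,
    LinearMap.mulLeft_apply, ← mul_assoc, ← pow_succ']
  simp [add_comm]

theorem ofPoly_opQ (f : MvPolynomial (Fin 2) K) : ofPoly (opQ f) = q * ofPoly f := by
  suffices h : ofPoly.comp opQ = (LinearMap.mulLeft K (q : WeylA1 K)).comp ofPoly from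
    LinearMap.congr_fun h f
  refine (MvPolynomial.basisMonomials (Fin 2) K).ext fun m => ?_
  have h : (X 1 * monomial m 1 : MvPolynomial (Fin 2) K)
      = monomial (Finsupp.single 1 1 + m) 1 := by
    rw [X, monomial_mul, one_mul]
  have h2 : (pderiv 0 (monomial m (1 : K)))
      = (m 0 : K) • monomial (m - Finsupp.single 0 1) (1 : K) := by
    rw [pderiv_monomial, smul_monomial]; simp
  simp only [MvPolynomial.coe_basisMonomials, LinearMap.comp_apply, opQ_apply, h, h2, map_sub,
    map_smul, ofPoly_monomial, LinearMap.mulLeft_apply, ← mul_assoc, q_mul_p_pow]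
  simp [sub_mul, mul_assoc, ← pow_succ', add_comm]

theorem ofPoly_act (z : WeylA1 K) (f : MvPolynomial (Fin 2) K) :
    ofPoly (act z f) = z * ofPoly f := by
  obtain ⟨a, rfl⟩ := RingQuot.mkAlgHom_surjective K (WeylRel K) z
  induction a using FreeAlgebra.induction generalizing f with
  | grade0 c => simp [Algebra.algebraMap_eq_smul_one]
  | grade1 i =>
    fin_cases i
    · change ofPoly (act p f) = p * ofPoly f
      rw [act_p, ofPoly_opP]
    · change ofPoly (act q f) = q * ofPoly f
      rw [act_q, ofPoly_opQ]
  | mul a b ha hb => rw [map_mul, map_mul, Module.End.mul_apply, ha, hb, mul_assoc]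
  | add a b ha hb => rw [map_add, map_add, LinearMap.add_apply, map_add, ha, hb, add_mul]

theorem ofPoly_one : ofPoly (1 : MvPolynomial (Fin 2) K) = 1 := by
  have h := ofPoly_monomial (K := K) 0
  simpa using h

theorem ofPoly_bijective : Function.Bijective (ofPoly (K := K)) :=
  ⟨Function.LeftInverse.injective (g := fun z => act z 1) act_ofPoly,
    fun z => ⟨act z 1, by rw [ofPoly_act, ofPoly_one, mul_one]⟩⟩

/-- The linear isomorphism `Φ : A₁ → K[X,Y]`, `pⁱqʲ ↦ XⁱYʲ`, that is, the inverse of `ofPoly`. -/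
def Phi : WeylA1 K ≃ₗ[K] MvPolynomial (Fin 2) K :=
  (LinearEquiv.ofBijective ofPoly ofPoly_bijective).symm

theorem Phi_p_pow_mul_q_pow (i j : ℕ) :
    Phi (p ^ i * q ^ j : WeylA1 K) = X 0 ^ i * X 1 ^ j := by
  have h : (X 0 ^ i * X 1 ^ j : MvPolynomial (Fin 2) K)
      = monomial (Finsupp.single 0 i + Finsupp.single 1 j) 1 := by
    rw [X_pow_eq_monomial, X_pow_eq_monomial, monomial_mul, one_mul]
  rw [Phi, LinearEquiv.symm_apply_eq, LinearEquiv.ofBijective_apply, h, ofPoly_monomial]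
  simp

/-- The number `ρ i + σ j` attached to the exponent `(i, j)` of the monomial `XⁱYʲ`. -/
def weight (ρ σ : ℝ) (m : Fin 2 →₀ ℕ) : ℝ := ρ * (m 0 : ℝ) + σ * (m 1 : ℝ)

/-- The `(ρ,σ)`-degree `sup {ρ i + σ j | αᵢⱼ ≠ 0}` of a nonzero polynomial `∑ αᵢⱼ XⁱYʲ`. -/
def polyDegree (ρ σ : ℝ) (f : MvPolynomial (Fin 2) K) : ℝ :=
  sSup (weight ρ σ '' (f.support : Set (Fin 2 →₀ ℕ)))

open Classical in
/-- The `(ρ,σ)`-leading component of a polynomial: the sum of its terms `αᵢⱼ XⁱYʲ` for which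
`ρ i + σ j` equals its `(ρ,σ)`-degree. -/
def polyLeading (ρ σ : ℝ) (f : MvPolynomial (Fin 2) K) : MvPolynomial (Fin 2) K :=
  ∑ m ∈ f.support.filter (fun m => weight ρ σ m = polyDegree ρ σ f), monomial m (coeff m f)

/-- The polynomial `(ρ,σ)`-associated with the element `z` of `A₁`. -/
def leading (ρ σ : ℝ) (z : WeylA1 K) : MvPolynomial (Fin 2) K := polyLeading ρ σ (Phi z)

/-- The Poisson product `{f,g} = f_X g_Y - f_Y g_X` on `K[X,Y]`. -/
def poisson (f g : MvPolynomial (Fin 2) K) : MvPolynomial (Fin 2) K :=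
  pderiv 0 f * pderiv 1 g - pderiv 1 f * pderiv 0 g

/-- The Poisson centralizer `C(f) = {g ∈ K[X,Y] | {f,g} = 0}`. -/
def poissonCentralizer (f : MvPolynomial (Fin 2) K) : Set (MvPolynomial (Fin 2) K) :=
  {g | poisson f g = 0}

end

end WeylA1

namespace WeylA1

noncomputable section

section

variable {K : Type*} [Field K]

theorem weight_add (ρ σ : ℝ) (m n : Fin 2 →₀ ℕ) :
    weight ρ σ (m + n) = weight ρ σ m + weight ρ σ n := by
  simp only [weight, Finsupp.add_apply, Nat.cast_add]; ring

/-- The polynomials all of whose monomials have `(ρ,σ)`-weight in `I`. -/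
def weightIn (K : Type*) [Field K] (ρ σ : ℝ) (I : Set ℝ) :
    Submodule K (MvPolynomial (Fin 2) K) where
  carrier := {f | ∀ m, coeff m f ≠ 0 → weight ρ σ m ∈ I}
  add_mem' {f g} hf hg m hm := by
    by_cases h : coeff m f = 0
    · exact hg m fun h' => hm (by rw [coeff_add, h, h', add_zero])
    · exact hf m h
  zero_mem' m hm := absurd (coeff_zero m) hm
  smul_mem' c f hf m hm := hf m fun h => hm (by rw [coeff_smul, h, smul_zero])

variable {ρ σ : ℝ} {I J L : Set ℝ} {f g : MvPolynomial (Fin 2) K}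

theorem coeff_eq_zero_of_mem_weightIn (hf : f ∈ weightIn K ρ σ I) {m : Fin 2 →₀ ℕ}
    (hm : weight ρ σ m ∉ I) : coeff m f = 0 :=
  not_not.1 fun h => hm (hf m h)

theorem weightIn_mono (h : I ⊆ J) : weightIn K ρ σ I ≤ weightIn K ρ σ J :=
  fun _ hf m hm => h (hf m hm)

theorem mul_mem_weightIn (hf : f ∈ weightIn K ρ σ I) (hg : g ∈ weightIn K ρ σ J)
    (h : ∀ x ∈ I, ∀ y ∈ J, x + y ∈ L) : f * g ∈ weightIn K ρ σ L := by
  intro m hm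
  rw [coeff_mul] at hm
  obtain ⟨⟨u, v⟩, huv, hne⟩ := Finset.exists_ne_zero_of_sum_ne_zero hm
  rw [← Finset.HasAntidiagonal.mem_antidiagonal.1 huv, weight_add]
  exact h _ (hf u (left_ne_zero_of_mul hne)) _ (hg v (right_ne_zero_of_mul hne))

theorem monomial_mem_weightIn {m : Fin 2 →₀ ℕ} (h : weight ρ σ m ∈ I) (c : K) :
    monomial m c ∈ weightIn K ρ σ I := by
  intro n hn
  classical
  rw [coeff_monomial] at hn
  by_cases hmn : m = n
  · rwa [← hmn]
  · simp [hmn] at hn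

theorem X_zero_mem_weightIn : (X 0 : MvPolynomial (Fin 2) K) ∈ weightIn K ρ σ {ρ} :=
  monomial_mem_weightIn (by simp [weight]) 1

theorem X_one_mem_weightIn : (X 1 : MvPolynomial (Fin 2) K) ∈ weightIn K ρ σ {σ} :=
  monomial_mem_weightIn (by simp [weight]) 1

theorem one_mem_weightIn (h : (0 : ℝ) ∈ I) : (1 : MvPolynomial (Fin 2) K) ∈ weightIn K ρ σ I :=
  monomial_mem_weightIn (by simpa [weight] using h) 1

theorem pow_mem_weightIn {d : ℝ} (hf : f ∈ weightIn K ρ σ {d}) (n : ℕ) :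
    f ^ n ∈ weightIn K ρ σ {n * d} := by
  induction n with
  | zero => rw [pow_zero]; exact one_mem_weightIn (by simp)
  | succ n ih =>
    rw [pow_succ]
    refine mul_mem_weightIn ih hf ?_
    rintro x rfl y rfl
    simp only [Set.mem_singleton_iff]; push_cast; ring

theorem pderiv_zero_mem_weightIn (hf : f ∈ weightIn K ρ σ I) (h : ∀ x ∈ I, x - ρ ∈ L) :
    pderiv 0 f ∈ weightIn K ρ σ L := by
  intro m hm
  rw [coeff_pderiv] at hm
  have := h _ (hf _ (left_ne_zero_of_mul hm))
  rw [weight_add] at this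
  simpa [weight] using this

theorem pderiv_one_mem_weightIn (hf : f ∈ weightIn K ρ σ I) (h : ∀ x ∈ I, x - σ ∈ L) :
    pderiv 1 f ∈ weightIn K ρ σ L := by
  intro m hm
  rw [coeff_pderiv] at hm
  have := h _ (hf _ (left_ne_zero_of_mul hm))
  rw [weight_add] at this
  simpa [weight] using this

theorem poisson_mem_weightIn (hf : f ∈ weightIn K ρ σ I) (hg : g ∈ weightIn K ρ σ J)
    (h : ∀ x ∈ I, ∀ y ∈ J, x + y - (ρ + σ) ∈ L) : poisson f g ∈ weightIn K ρ σ L := by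
  refine sub_mem
    (mul_mem_weightIn (I := (· - ρ) '' I) (J := (· - σ) '' J)
      (pderiv_zero_mem_weightIn hf fun x hx => ⟨x, hx, rfl⟩)
      (pderiv_one_mem_weightIn hg fun x hx => ⟨x, hx, rfl⟩) ?_)
    (mul_mem_weightIn (I := (· - σ) '' I) (J := (· - ρ) '' J)
      (pderiv_one_mem_weightIn hf fun x hx => ⟨x, hx, rfl⟩)
      (pderiv_zero_mem_weightIn hg fun x hx => ⟨x, hx, rfl⟩) ?_)
  all_goals
    rintro _ ⟨x, hx, rfl⟩ _ ⟨y, hy, rfl⟩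
    convert h x hx y hy using 1
    ring

theorem act_Phi_one (z : WeylA1 K) : Phi z = act z 1 := by
  rw [Phi, LinearEquiv.symm_apply_eq, LinearEquiv.ofBijective_apply, ofPoly_act, ofPoly_one,
    mul_one]

theorem Phi_mul (z w : WeylA1 K) : Phi (z * w) = act z (Phi w) := by
  rw [act_Phi_one, act_Phi_one, map_mul, Module.End.mul_apply]

theorem Phi_one : Phi (1 : WeylA1 K) = 1 := by
  rw [act_Phi_one, map_one act, Module.End.one_apply]

theorem ofPoly_Phi (z : WeylA1 K) : ofPoly (Phi z) = z := by
  rw [act_Phi_one, ofPoly_act, ofPoly_one, mul_one]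

theorem opQ_pow_sub_mem {β : ℝ} (h : 0 < ρ + σ) (hg : g ∈ weightIn K ρ σ (Set.Iic β)) (j : ℕ) :
    (opQ ^ j) g - X 1 ^ j * g + pderiv 1 (X 1 ^ j) * pderiv 0 g
      ∈ weightIn K ρ σ (Set.Iic (j * σ + β - 2 * (ρ + σ))) := by
  induction j with
  | zero => simp
  | succ j ih =>
    set R := (opQ ^ j) g - X 1 ^ j * g + pderiv 1 (X 1 ^ j) * pderiv 0 g with hR
    have hT : (opQ ^ j) g = R + X 1 ^ j * g - pderiv 1 (X 1 ^ j) * pderiv 0 g := by rw [hR]; ring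
    have h0 : pderiv 0 (X 1 ^ j : MvPolynomial (Fin 2) K) = 0 := by
      rw [pderiv_pow, pderiv_X_of_ne (by decide), mul_zero]
    have h1 : pderiv 0 (pderiv 1 (X 1 ^ j : MvPolynomial (Fin 2) K)) = 0 := by
      rw [pderiv_pow, pderiv_X_self, mul_one]
      rw [pderiv_mul, pderiv_pow, pderiv_X_of_ne (by decide)]
      simp
    have key : (opQ ^ (j + 1)) g - X 1 ^ (j + 1) * g + pderiv 1 (X 1 ^ (j + 1)) * pderiv 0 g
        = X 1 * R - pderiv 0 R + pderiv 1 (X 1 ^ j) * pderiv 0 (pderiv 0 g) := by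
      rw [pow_succ', Module.End.mul_apply, opQ_apply, hT, pow_succ' (X 1), pderiv_mul (i := 1),
        pderiv_X_self]
      simp only [map_add, map_sub, pderiv_mul, h0, h1]
      ring
    rw [key]
    refine add_mem (sub_mem (mul_mem_weightIn X_one_mem_weightIn ih ?_)
      (pderiv_zero_mem_weightIn ih ?_))
      (mul_mem_weightIn (I := {j * σ - σ}) (J := Set.Iic (β - ρ - ρ))
        (pderiv_one_mem_weightIn (pow_mem_weightIn X_one_mem_weightIn j) ?_)
        (pderiv_zero_mem_weightIn (I := Set.Iic (β - ρ)) (pderiv_zero_mem_weightIn hg ?_) ?_) ?_)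
    · rintro x rfl y hy
      simp only [Set.mem_Iic] at hy ⊢
      push_cast; linarith
    · intro x hx
      simp only [Set.mem_Iic] at hx ⊢
      push_cast; linarith
    · rintro x rfl; rfl
    · intro x hx
      simp only [Set.mem_Iic] at hx ⊢
      linarith
    · intro x hx
      simp only [Set.mem_Iic] at hx ⊢
      linarith
    · rintro x rfl y hy
      simp only [Set.mem_Iic] at hy ⊢
      push_cast; linarith

theorem act_ofPoly_sub_mem {α β : ℝ} (h : 0 < ρ + σ) (hf : f ∈ weightIn K ρ σ (Set.Iic α))
    (hg : g ∈ weightIn K ρ σ (Set.Iic β)) :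
    act (ofPoly f) g - f * g + pderiv 1 f * pderiv 0 g
      ∈ weightIn K ρ σ (Set.Iic (α + β - 2 * (ρ + σ))) := by
  let T : MvPolynomial (Fin 2) K →ₗ[K] MvPolynomial (Fin 2) K :=
    (LinearMap.applyₗ g).comp (act.toLinearMap.comp ofPoly) - LinearMap.mulRight K g
      + (LinearMap.mulRight K (pderiv 0 g)).comp (pderiv 1).toLinearMap
  change T f ∈ _
  rw [f.as_sum, map_sum]
  refine sum_mem fun m hm => ?_
  have hw : weight ρ σ m ≤ α := hf m (mem_support_iff.1 hm)
  have hmon : monomial m (coeff m f) = coeff m f • monomial m (1 : K) := by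
    rw [smul_monomial, smul_eq_mul, mul_one]
  have hX : monomial m (1 : K) = X 0 ^ m 0 * X 1 ^ m 1 := by
    rw [MvPolynomial.monomial_eq, Finsupp.prod_fintype _ _ (by simp)]
    simp
  have h1 : pderiv 1 (X 0 ^ m 0 : MvPolynomial (Fin 2) K) = 0 := by
    rw [pderiv_pow, pderiv_X_of_ne (by decide), mul_zero]
  have hT : T (monomial m (1 : K)) = X 0 ^ m 0 *
      ((opQ ^ m 1) g - X 1 ^ m 1 * g + pderiv 1 (X 1 ^ m 1) * pderiv 0 g) := by
    change act (ofPoly (monomial m (1 : K))) g - monomial m 1 * g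
      + pderiv 1 (monomial m (1 : K)) * pderiv 0 g = _
    rw [ofPoly_monomial, map_mul, map_pow, map_pow, act_p, act_q, Module.End.mul_apply, opP_pow,
      hX, pderiv_mul, h1]
    ring
  rw [hmon, map_smul, hT]
  refine Submodule.smul_mem _ _ (mul_mem_weightIn (pow_mem_weightIn X_zero_mem_weightIn _)
    (opQ_pow_sub_mem h hg _) ?_)
  rintro x rfl y hy
  simp only [Set.mem_Iic, weight] at hy hw ⊢
  linarith

variable {z w : WeylA1 K} {α β : ℝ}

theorem Phi_mul_sub_mem (h : 0 < ρ + σ) (hz : Phi z ∈ weightIn K ρ σ (Set.Iic α))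
    (hw : Phi w ∈ weightIn K ρ σ (Set.Iic β)) :
    Phi (z * w) - Phi z * Phi w ∈ weightIn K ρ σ (Set.Iio (α + β)) := by
  have h1 := act_ofPoly_sub_mem h hz hw
  rw [ofPoly_Phi, ← Phi_mul] at h1
  have h2 : pderiv 1 (Phi z) * pderiv 0 (Phi w) ∈ weightIn K ρ σ (Set.Iio (α + β)) := by
    refine mul_mem_weightIn (I := Set.Iic (α - σ)) (J := Set.Iic (β - ρ))
      (pderiv_one_mem_weightIn hz ?_) (pderiv_zero_mem_weightIn hw ?_) ?_
    · intro x hx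
      simp only [Set.mem_Iic] at hx ⊢
      linarith
    · intro x hx
      simp only [Set.mem_Iic] at hx ⊢
      linarith
    · intro x hx y hy
      simp only [Set.mem_Iic, Set.mem_Iio] at hx hy ⊢
      linarith
  have h3 := sub_mem (weightIn_mono (J := Set.Iio (α + β)) (fun x hx => ?_) h1) h2
  · rwa [add_sub_cancel_right] at h3
  · simp only [Set.mem_Iic, Set.mem_Iio] at hx ⊢
    linarith

theorem Phi_commutator_sub_poisson_mem (h : 0 < ρ + σ)
    (hz : Phi z ∈ weightIn K ρ σ (Set.Iic α)) (hw : Phi w ∈ weightIn K ρ σ (Set.Iic β)) :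
    Phi (z * w - w * z) - poisson (Phi z) (Phi w)
      ∈ weightIn K ρ σ (Set.Iic (α + β - 2 * (ρ + σ))) := by
  have h1 := act_ofPoly_sub_mem h hz hw
  have h2 := act_ofPoly_sub_mem h hw hz
  rw [ofPoly_Phi, ← Phi_mul] at h1 h2
  rw [add_comm β α] at h2
  convert sub_mem h1 h2 using 1
  rw [map_sub, poisson]
  ring

end

section

variable {K : Type*} [Field K]

theorem coeff_X_mul_pderiv (i : Fin 2) (f : MvPolynomial (Fin 2) K) (m : Fin 2 →₀ ℕ) :
    coeff m (X i * pderiv i f) = m i * coeff m f := by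
  rw [coeff_X_mul']
  split_ifs with h
  · have h1 : 1 ≤ m i := Nat.one_le_iff_ne_zero.2 (Finsupp.mem_support_iff.1 h)
    rw [coeff_pderiv, tsub_add_cancel_of_le (Finsupp.single_le_iff.2 h1), mul_comm]
    congr 1
    simp [Nat.cast_sub h1]
  · rw [Finsupp.notMem_support_iff.1 h, Nat.cast_zero, zero_mul]

theorem coeff_jacobian (a b : Fin 2) (f g : MvPolynomial (Fin 2) K) (m : Fin 2 →₀ ℕ) :
    coeff m (pderiv a f * pderiv b g - pderiv b f * pderiv a g)
      = ∑ x ∈ Finset.HasAntidiagonal.antidiagonal (Finsupp.single a 1 + (Finsupp.single b 1 + m)),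
        coeff x.1 f * coeff x.2 g * (x.1 a * x.2 b - x.1 b * x.2 a) := by
  have h : X a * (X b * (pderiv a f * pderiv b g - pderiv b f * pderiv a g))
      = (X a * pderiv a f) * (X b * pderiv b g) - (X b * pderiv b f) * (X a * pderiv a g) := by
    ring
  rw [← coeff_X_mul m b, ← coeff_X_mul _ a, h, coeff_sub, coeff_mul, coeff_mul,
    ← Finset.sum_sub_distrib]
  refine Finset.sum_congr rfl fun x _ => ?_
  simp only [coeff_X_mul_pderiv]
  ring

variable {a b : Fin 2} {f g : MvPolynomial (Fin 2) K} {s : ℝ}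

theorem coeff_mul_coeff_eq_one (hab : a ≠ b) (hs1 : s < 1)
    (hg : ∀ v ∈ g.support, (v a : ℝ) + s * v b ≤ s)
    (h : coeff 0 (pderiv a f * pderiv b g - pderiv b f * pderiv a g) = 1) :
    coeff (Finsupp.single a 1) f * coeff (Finsupp.single b 1) g = 1 := by
  have hga : coeff (Finsupp.single a 1) g = 0 := by
    by_contra hne
    have := hg _ (mem_support_iff.2 hne)
    simp [hab] at this
    linarith
  rw [coeff_sub, ← constantCoeff_eq, map_mul, map_mul] at h
  simpa [constantCoeff_eq, coeff_pderiv, hga] using h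

/-- If the Jacobian of `f` and `g` is `1` in weight `0` for the weight `(1,s)`, then the edges of
the supports of `f` and `g` on the lines of weight `1` and `s` end at the linear terms. -/
theorem edge_trivial [CharZero K] (hab : a ≠ b) (hs0 : s ≤ 0)
    (hf : ∀ u ∈ f.support, (u a : ℝ) + s * u b ≤ 1)
    (hg : ∀ v ∈ g.support, (v a : ℝ) + s * v b ≤ s)
    (h : ∀ m : Fin 2 →₀ ℕ, (m a : ℝ) + s * m b = 0 →
      coeff m (pderiv a f * pderiv b g - pderiv b f * pderiv a g) = coeff m 1) :
    (∀ u ∈ f.support, (u a : ℝ) + s * u b = 1 → u b = 0) ∧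
      ∀ v ∈ g.support, (v a : ℝ) + s * v b = s → v b ≤ 1 := by
  classical
  have h1 := coeff_mul_coeff_eq_one hab (by linarith) hg ((h 0 (by simp)).trans coeff_zero_one)
  have hfa : Finsupp.single a 1 ∈ f.support.filter fun u => (u a : ℝ) + s * u b = 1 := by
    refine Finset.mem_filter.2 ⟨mem_support_iff.2 (left_ne_zero_of_mul (h1.trans_ne one_ne_zero)), ?_⟩
    simp [hab]
  have hgb : Finsupp.single b 1 ∈ g.support.filter fun v => (v a : ℝ) + s * v b = s := by
    refine Finset.mem_filter.2 ⟨mem_support_iff.2 (right_ne_zero_of_mul (h1.trans_ne one_ne_zero)), ?_⟩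
    simp [hab.symm]
  obtain ⟨u₀, hu₀, hu₀max⟩ := Finset.exists_max_image _ (fun u => u b) ⟨_, hfa⟩
  obtain ⟨v₀, hv₀, hv₀max⟩ := Finset.exists_max_image _ (fun v => v b) ⟨_, hgb⟩
  have hv1 : 1 ≤ v₀ b := by simpa using hv₀max _ hgb
  rw [Finset.mem_filter] at hu₀ hv₀
  have hu1 : 1 ≤ u₀ a := by
    have : (0 : ℝ) ≤ -s * u₀ b := mul_nonneg (by linarith) (Nat.cast_nonneg _)
    have h2 : (1 : ℝ) ≤ u₀ a := by linarith [hu₀.2]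
    exact_mod_cast h2
  have hext : ∀ m n : Fin 2 →₀ ℕ, m a = n a → m b = n b → m = n := by
    intro m n h1 h2
    ext i
    have : i = a ∨ i = b := by omega
    rcases this with rfl | rfl <;> assumption
  obtain ⟨m, hm⟩ : ∃ m, Finsupp.single a 1 + (Finsupp.single b 1 + m) = u₀ + v₀ := by
    refine ⟨u₀ + v₀ - (Finsupp.single a 1 + Finsupp.single b 1), ?_⟩
    rw [← add_assoc]
    refine hext _ _ ?_ ?_
    · simp [hab]; omega
    · simp [hab.symm]; omega
  have hma : 1 + m a = u₀ a + v₀ a := by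
    simpa [Finsupp.single_apply, hab, hab.symm] using DFunLike.congr_fun hm a
  have hmb : 1 + m b = u₀ b + v₀ b := by
    simpa [Finsupp.single_apply, hab, hab.symm] using DFunLike.congr_fun hm b
  have hmaR : (1 : ℝ) + m a = u₀ a + v₀ a := by exact_mod_cast hma
  have hmbR : (1 : ℝ) + m b = u₀ b + v₀ b := by exact_mod_cast hmb
  have hm0 : (m a : ℝ) + s * m b = 0 := by
    linear_combination hmaR + s * hmbR + hu₀.2 + hv₀.2
  have hcoeff := h m hm0
  rw [coeff_jacobian, hm, Finset.sum_eq_single (u₀, v₀)] at hcoeff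
  · have hne : (u₀ a * v₀ b : K) - u₀ b * v₀ a ≠ 0 := by
      rw [sub_ne_zero]
      intro heq
      have heq' : (u₀ a * v₀ b : ℝ) = u₀ b * v₀ a := by exact_mod_cast heq
      have h3 : (v₀ b : ℝ) = s * u₀ b := by
        linear_combination heq' - v₀ b * hu₀.2 + u₀ b * hv₀.2
      have h4 : (1 : ℝ) ≤ v₀ b := by exact_mod_cast hv1
      have : (0 : ℝ) ≤ -s * u₀ b := mul_nonneg (by linarith) (Nat.cast_nonneg _)
      linarith
    have hne' : coeff m (1 : MvPolynomial (Fin 2) K) ≠ 0 := by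
      rw [← hcoeff]
      exact mul_ne_zero (mul_ne_zero (mem_support_iff.1 hu₀.1) (mem_support_iff.1 hv₀.1)) hne
    have hmz : m = 0 := by
      rw [coeff_one] at hne'
      by_contra hne0
      exact hne' (if_neg (Ne.symm hne0))
    rw [hmz] at hmb
    simp only [Finsupp.coe_zero, Pi.zero_apply] at hmb
    refine ⟨fun u hu hu' => ?_, fun v hv hv' => ?_⟩
    · have := hu₀max u (Finset.mem_filter.2 ⟨hu, hu'⟩)
      omega
    · have := hv₀max v (Finset.mem_filter.2 ⟨hv, hv'⟩)
      omega
  · rintro ⟨u, v⟩ huv hne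
    rw [Finset.HasAntidiagonal.mem_antidiagonal] at huv
    by_contra hprod
    have hprod' := left_ne_zero_of_mul hprod
    have hu := mem_support_iff.2 (left_ne_zero_of_mul hprod')
    have hv := mem_support_iff.2 (right_ne_zero_of_mul hprod')
    have ea : u a + v a = u₀ a + v₀ a := DFunLike.congr_fun huv a
    have eb : u b + v b = u₀ b + v₀ b := DFunLike.congr_fun huv b
    have eaR : (u a + v a : ℝ) = u₀ a + v₀ a := by exact_mod_cast ea
    have ebR : (u b + v b : ℝ) = u₀ b + v₀ b := by exact_mod_cast eb
    have hsum : ((u a : ℝ) + s * u b) + (v a + s * v b) = 1 + s := by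
      linear_combination eaR + s * ebR + hu₀.2 + hv₀.2
    have hfu := hf u hu
    have hgv := hg v hv
    have hu' : (u a : ℝ) + s * u b = 1 := by linarith
    have hv' : (v a : ℝ) + s * v b = s := by linarith
    have hub := hu₀max u (Finset.mem_filter.2 ⟨hu, hu'⟩)
    have hvb := hv₀max v (Finset.mem_filter.2 ⟨hv, hv'⟩)
    have eub : u b = u₀ b := by omega
    have evb : v b = v₀ b := by omega
    have eua : u a = u₀ a := by
      have : (u a : ℝ) = u₀ a := by
        have := hu₀.2
        rw [eub] at hu'
        linarith
      exact_mod_cast this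
    have eva : v a = v₀ a := by omega
    exact hne (by rw [hext u u₀ eua eub, hext v v₀ eva evb])
  · intro hnot
    refine absurd ?_ hnot
    rw [Finset.HasAntidiagonal.mem_antidiagonal]

/-- By turning the direction `(1,s)` to `(1,0)` one sees that `f` is a multiple of the variable `a`
plus a polynomial in `b`, and that `g` is linear in `b`. -/
theorem support_of_jacobian_eq_one [CharZero K] (hab : a ≠ b) {r : ℝ} (hr : -1 < r) (hr1 : r < 1)
    (hf : ∀ u ∈ f.support, (u a : ℝ) + r * u b ≤ 1)
    (hg : ∀ v ∈ g.support, (v a : ℝ) + r * v b ≤ r)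
    (h : ∀ s : ℝ, -1 < s → (∀ u ∈ f.support, (u a : ℝ) + s * u b ≤ 1) →
      (∀ v ∈ g.support, (v a : ℝ) + s * v b ≤ s) → ∀ m : Fin 2 →₀ ℕ, (m a : ℝ) + s * m b = 0 →
      coeff m (pderiv a f * pderiv b g - pderiv b f * pderiv a g) = coeff m 1) :
    (∀ u ∈ f.support, u a = 0 ∨ u a = 1 ∧ u b = 0) ∧
      ∀ v ∈ g.support, v a = 0 ∧ v b ≤ 1 := by
  classical
  rcases lt_or_ge 0 r with hr0 | hr0
  · refine ⟨fun u hu => ?_, fun v hv => ?_⟩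
    · have h1 := hf u hu
      have h2 : (0 : ℝ) ≤ r * u b := by positivity
      have h3 : (u a : ℝ) ≤ 1 := by linarith
      have h4 : u a ≤ 1 := by exact_mod_cast h3
      rcases Nat.le_one_iff_eq_zero_or_eq_one.1 h4 with h5 | h5
      · exact Or.inl h5
      · refine Or.inr ⟨h5, ?_⟩
        rw [h5, Nat.cast_one] at h1
        have h6 : r * u b = 0 := by linarith
        exact_mod_cast (mul_eq_zero.1 h6).resolve_left hr0.ne'
    · have h1 := hg v hv
      have h2 : (0 : ℝ) ≤ r * v b := by positivity
      have h3 : (v a : ℝ) < 1 := by linarith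
      have h4 : v a = 0 := by
        have : v a < 1 := by exact_mod_cast h3
        omega
      refine ⟨h4, ?_⟩
      rw [h4, Nat.cast_zero, zero_add] at h1
      have h5 : (v b : ℝ) ≤ 1 := by
        by_contra! hlt
        nlinarith
      exact_mod_cast h5
  · let B : Finset ℝ := insert 0
      ((f.support.filter fun u => 2 ≤ u a).image (fun u => (1 - u a : ℝ) / u b) ∪
        (g.support.filter fun v => 1 ≤ v a).image (fun v => (-v a : ℝ) / (v b - 1)))
    have hf2 : ∀ u ∈ f.support, 2 ≤ u a → (0 : ℝ) < u b := by
      intro u hu h2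
      have h3 := hf u hu
      have h4 : (2 : ℝ) ≤ u a := by exact_mod_cast h2
      by_contra! hle
      nlinarith
    have hg1 : ∀ v ∈ g.support, 1 ≤ v a → (0 : ℝ) < v b - 1 := by
      intro v hv h2
      have h3 := hg v hv
      have h4 : (1 : ℝ) ≤ v a := by exact_mod_cast h2
      by_contra! hle
      nlinarith
    have hB : B.Nonempty := ⟨0, Finset.mem_insert_self _ _⟩
    set s := B.min' hB with hsdef
    have hs0 : s ≤ 0 := B.min'_le 0 (Finset.mem_insert_self _ _)
    have hsf : ∀ u ∈ f.support, 2 ≤ u a → s ≤ (1 - u a : ℝ) / u b := fun u hu h2 =>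
      B.min'_le _ (Finset.mem_insert_of_mem (Finset.mem_union_left _
        (Finset.mem_image_of_mem _ (Finset.mem_filter.2 ⟨hu, h2⟩))))
    have hsg : ∀ v ∈ g.support, 1 ≤ v a → s ≤ (-v a : ℝ) / (v b - 1) := fun v hv h2 =>
      B.min'_le _ (Finset.mem_insert_of_mem (Finset.mem_union_right _
        (Finset.mem_image_of_mem _ (Finset.mem_filter.2 ⟨hv, h2⟩))))
    have hcases : s = 0 ∨ (∃ u ∈ f.support, 2 ≤ u a ∧ (1 - u a : ℝ) / u b = s) ∨
        ∃ v ∈ g.support, 1 ≤ v a ∧ (-v a : ℝ) / (v b - 1) = s := by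
      have := B.min'_mem hB
      simp only [B, Finset.mem_insert, Finset.mem_union, Finset.mem_image, Finset.mem_filter,
        and_assoc] at this
      exact this
    have hrs : r ≤ s := by
      rcases hcases with h0 | ⟨u, hu, h2, h3⟩ | ⟨v, hv, h2, h3⟩
      · rwa [h0]
      · rw [← h3, le_div_iff₀ (hf2 u hu h2)]
        linarith [hf u hu]
      · rw [← h3, le_div_iff₀ (hg1 v hv h2)]
        linarith [hg v hv]
    have hs : -1 < s := by linarith
    have hfs : ∀ u ∈ f.support, (u a : ℝ) + s * u b ≤ 1 := by
      intro u hu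
      rcases lt_or_ge (u a) 2 with h2 | h2
      · have h3 : (u a : ℝ) ≤ 1 := by exact_mod_cast Nat.lt_succ_iff.1 h2
        have : s * u b ≤ 0 := mul_nonpos_of_nonpos_of_nonneg hs0 (Nat.cast_nonneg _)
        linarith
      · have h3 := hsf u hu h2
        rw [le_div_iff₀ (hf2 u hu h2)] at h3
        linarith
    have hgs : ∀ v ∈ g.support, (v a : ℝ) + s * v b ≤ s := by
      intro v hv
      rcases Nat.eq_zero_or_pos (v a) with h2 | h2
      · rw [h2, Nat.cast_zero, zero_add]
        rcases Nat.eq_zero_or_pos (v b) with h3 | h3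
        · have h4 := hg v hv
          rw [h2, h3] at h4
          rw [h3]
          simp only [Nat.cast_zero, zero_add, mul_zero] at h4 ⊢
          linarith
        · have h4 : (1 : ℝ) ≤ v b := by exact_mod_cast h3
          nlinarith
      · have h3 := hsg v hv h2
        rw [le_div_iff₀ (hg1 v hv h2)] at h3
        linarith
    obtain ⟨hE, hE'⟩ := edge_trivial hab hs0 hfs hgs (h s hs hfs hgs)
    have hs00 : s = 0 := by
      rcases hcases with h0 | ⟨u, hu, h2, h3⟩ | ⟨v, hv, h2, h3⟩
      · exact h0
      · have hpos := hf2 u hu h2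
        rw [div_eq_iff hpos.ne'] at h3
        rw [hE u hu (by linarith)] at hpos
        simp at hpos
      · have hpos := hg1 v hv h2
        rw [div_eq_iff hpos.ne'] at h3
        have h4 : (v b : ℝ) ≤ 1 := by exact_mod_cast hE' v hv (by linarith)
        linarith
    rw [hs00] at hfs hgs hE hE'
    simp only [zero_mul, add_zero] at hfs hgs hE hE'
    refine ⟨fun u hu => ?_, fun v hv => ?_⟩
    · have h4 : u a ≤ 1 := by exact_mod_cast hfs u hu
      rcases Nat.le_one_iff_eq_zero_or_eq_one.1 h4 with h5 | h5
      · exact Or.inl h5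
      · exact Or.inr ⟨h5, hE u hu (by rw [h5, Nat.cast_one])⟩
    · have h4 : v a = 0 := by
        have : v a ≤ 0 := by exact_mod_cast hgs v hv
        omega
      exact ⟨h4, hE' v hv (by rw [h4, Nat.cast_zero])⟩

end

section

variable {K : Type*} [Field K] {S : Subalgebra K (WeylA1 K)}

/-- The generators `p` and `q`, indexed as the variables of `K[X,Y]`. -/
def gen (i : Fin 2) : WeylA1 K := ![p, q] i

theorem ofPoly_eq_sum (f : MvPolynomial (Fin 2) K) :
    ofPoly f = ∑ u ∈ f.support, coeff u f • (p ^ u 0 * q ^ u 1 : WeylA1 K) := by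
  conv_lhs => rw [f.as_sum, map_sum]
  refine Finset.sum_congr rfl fun u _ => ?_
  rw [← ofPoly_monomial, ← map_smul, smul_monomial, smul_eq_mul, mul_one]

theorem eq_top_of_gen_mem (h : ∀ i, (gen i : WeylA1 K) ∈ S) : S = ⊤ := by
  refine eq_top_iff.2 fun z _ => ?_
  rw [← ofPoly_Phi z, ofPoly_eq_sum]
  exact sum_mem fun u _ => S.smul_mem (S.mul_mem (S.pow_mem (h 0) _) (S.pow_mem (h 1) _)) _

theorem pow_mul_pow_mem {a b : Fin 2} (hab : a ≠ b) (hb : (gen b : WeylA1 K) ∈ S)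
    {u : Fin 2 →₀ ℕ} (hu : u a = 0) : (p ^ u 0 * q ^ u 1 : WeylA1 K) ∈ S := by
  have h : ∀ i, (gen i ^ u i : WeylA1 K) ∈ S := by
    intro i
    have : i = a ∨ i = b := by omega
    rcases this with rfl | rfl
    · rw [hu, pow_zero]; exact S.one_mem
    · exact S.pow_mem hb _
  exact S.mul_mem (h 0) (h 1)

theorem pow_single_mul_pow_single (a : Fin 2) :
    (p ^ Finsupp.single a 1 0 * q ^ Finsupp.single a 1 1 : WeylA1 K) = gen a := by
  fin_cases a <;> simp [gen]

theorem eq_single_of_apply {a b : Fin 2} (hab : a ≠ b) {u : Fin 2 →₀ ℕ} (ha : u a = 1)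
    (hb : u b = 0) : u = Finsupp.single a 1 := by
  ext i
  have : i = a ∨ i = b := by omega
  rcases this with rfl | rfl
  · simpa using ha
  · simp [hab.symm, hb]

/-- If all terms of `f` but the linear one in the variable `a` lie in `S`, then so does the
generator `a`, provided that `f` lies in `S`. -/
theorem gen_mem_of_ofPoly_mem {a : Fin 2} {f : MvPolynomial (Fin 2) K} (hf : ofPoly f ∈ S)
    (hc : coeff (Finsupp.single a 1) f ≠ 0)
    (h : ∀ u ∈ f.support, u ≠ Finsupp.single a 1 → (p ^ u 0 * q ^ u 1 : WeylA1 K) ∈ S) :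
    gen a ∈ S := by
  classical
  rw [ofPoly_eq_sum, ← Finset.add_sum_erase _ _ (mem_support_iff.2 hc),
    pow_single_mul_pow_single] at hf
  have h2 : ∑ u ∈ f.support.erase (Finsupp.single a 1),
      coeff u f • (p ^ u 0 * q ^ u 1 : WeylA1 K) ∈ S :=
    sum_mem fun u hu => S.smul_mem (h u (Finset.mem_of_mem_erase hu) (Finset.ne_of_mem_erase hu)) _
  have h3 := S.smul_mem (S.sub_mem hf h2) (coeff (Finsupp.single a 1) f)⁻¹
  rwa [add_sub_cancel_right, smul_smul, inv_mul_cancel₀ hc, one_smul] at h3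

theorem eq_top_of_support {a b : Fin 2} (hab : a ≠ b) {f g : MvPolynomial (Fin 2) K}
    (hf : ofPoly f ∈ S) (hg : ofPoly g ∈ S)
    (hc : coeff (Finsupp.single a 1) f * coeff (Finsupp.single b 1) g = 1)
    (hfs : ∀ u ∈ f.support, u a = 0 ∨ u a = 1 ∧ u b = 0)
    (hgs : ∀ v ∈ g.support, v a = 0 ∧ v b ≤ 1) : S = ⊤ := by
  have hb : (gen b : WeylA1 K) ∈ S := by
    refine gen_mem_of_ofPoly_mem hg (right_ne_zero_of_mul (hc.trans_ne one_ne_zero))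
      fun v hv hne => ?_
    obtain ⟨h0, h1⟩ := hgs v hv
    rcases Nat.le_one_iff_eq_zero_or_eq_one.1 h1 with h2 | h2
    · have h : ∀ i, v i = 0 := by
        intro i
        have : i = a ∨ i = b := by omega
        rcases this with rfl | rfl <;> assumption
      rw [h, h, pow_zero, pow_zero, mul_one]
      exact S.one_mem
    · exact absurd (eq_single_of_apply hab.symm h2 h0) hne
  have ha : (gen a : WeylA1 K) ∈ S := by
    refine gen_mem_of_ofPoly_mem hf (left_ne_zero_of_mul (hc.trans_ne one_ne_zero))
      fun u hu hne => ?_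
    rcases hfs u hu with h | ⟨h, h'⟩
    · exact pow_mul_pow_mem hab hb h
    · exact absurd (eq_single_of_apply hab h h') hne
  refine eq_top_of_gen_mem fun i => ?_
  have : i = a ∨ i = b := by omega
  rcases this with rfl | rfl <;> assumption

theorem eq_top_of_linear {f g : MvPolynomial (Fin 2) K} (hf : ofPoly f ∈ S) (hg : ofPoly g ∈ S)
    (hc : coeff (Finsupp.single 0 1) f * coeff (Finsupp.single 1 1) g
      - coeff (Finsupp.single 1 1) f * coeff (Finsupp.single 0 1) g = 1)
    (hfs : ∀ u ∈ f.support, u 0 + u 1 ≤ 1) (hgs : ∀ v ∈ g.support, v 0 + v 1 ≤ 1) : S = ⊤ := by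
  set c₀ := coeff (Finsupp.single 0 1) f
  set c₁ := coeff (Finsupp.single 1 1) f
  set d₀ := coeff (Finsupp.single 0 1) g
  set d₁ := coeff (Finsupp.single 1 1) g
  have hsupp : ∀ x y : K, ∀ u ∈ (x • f - y • g).support, u 0 + u 1 ≤ 1 := by
    classical
    intro x y u hu
    rcases Finset.mem_union.1 (support_sub (Fin 2) _ _ hu) with h | h
    · exact hfs u (support_smul h)
    · exact hgs u (support_smul h)
  refine eq_top_of_support (a := 0) (b := 1) (by decide) (f := d₁ • f - c₁ • g)
    (g := (-d₀) • f - (-c₀) • g) ?_ ?_ ?_ ?_ ?_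
  · rw [map_sub, map_smul, map_smul]
    exact S.sub_mem (S.smul_mem hf _) (S.smul_mem hg _)
  · rw [map_sub, map_smul, map_smul]
    exact S.sub_mem (S.smul_mem hf _) (S.smul_mem hg _)
  · simp only [coeff_sub, coeff_smul, smul_eq_mul]
    change (d₁ * c₀ - c₁ * d₀) * (-d₀ * c₁ - -c₀ * d₁) = 1
    linear_combination (c₀ * d₁ - c₁ * d₀ + 1) * hc
  · intro u hu
    have := hsupp _ _ u hu
    omega
  · intro v hv
    have h := hsupp _ _ v hv
    refine ⟨?_, by omega⟩
    by_contra hne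
    have hv' : v = Finsupp.single 0 1 :=
      eq_single_of_apply (b := 1) (by decide) (by omega) (by omega)
    refine mem_support_iff.1 hv ?_
    rw [hv']
    simp only [coeff_sub, coeff_smul, smul_eq_mul]
    change -d₀ * c₀ - -c₀ * d₀ = 0
    ring

theorem coeff_zero_poisson (f g : MvPolynomial (Fin 2) K) :
    coeff 0 (poisson f g) = coeff (Finsupp.single 0 1) f * coeff (Finsupp.single 1 1) g
      - coeff (Finsupp.single 1 1) f * coeff (Finsupp.single 0 1) g := by
  rw [poisson, coeff_sub, ← constantCoeff_eq, map_mul, map_mul]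
  simp [constantCoeff_eq, coeff_pderiv]

theorem add_div_mul_le_div {r s x y c : ℝ} (hr : 0 < r) (h : r * x + s * y ≤ c) :
    x + s / r * y ≤ c / r := by
  rw [le_div_iff₀ hr]
  calc (x + s / r * y) * r = r * x + s * y := by field_simp
    _ ≤ c := h

theorem eq_top_of_commutator_eq_one [CharZero K] {z w : WeylA1 K} {ρ σ : ℝ} (h : 0 < ρ + σ)
    (hzw : z * w - w * z = 1) (hz : Phi z ∈ weightIn K ρ σ (Set.Iic ρ))
    (hw : Phi w ∈ weightIn K ρ σ (Set.Iic σ)) (hzS : z ∈ S) (hwS : w ∈ S) : S = ⊤ := by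
  have hP : ∀ ρ' σ' : ℝ, 0 < ρ' + σ' → Phi z ∈ weightIn K ρ' σ' (Set.Iic ρ') →
      Phi w ∈ weightIn K ρ' σ' (Set.Iic σ') → ∀ m, weight ρ' σ' m = 0 →
      coeff m (poisson (Phi z) (Phi w)) = coeff m 1 := by
    intro ρ' σ' h' hz' hw' m hm
    have h1 := Phi_commutator_sub_poisson_mem h' hz' hw'
    rw [hzw, Phi_one] at h1
    have h2 := coeff_eq_zero_of_mem_weightIn h1 (m := m)
      (by rw [hm, Set.mem_Iic, not_le]; linarith)
    rw [coeff_sub, sub_eq_zero] at h2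
    exact h2.symm
  have hc := hP ρ σ h hz hw 0 (by simp [weight])
  have hzS' : ofPoly (Phi z) ∈ S := by rwa [ofPoly_Phi]
  have hwS' : ofPoly (Phi w) ∈ S := by rwa [ofPoly_Phi]
  rcases lt_trichotomy ρ σ with hlt | heq | hlt
  · have hσ : 0 < σ := by linarith
    have hf : ∀ u ∈ (Phi w).support, (u 1 : ℝ) + ρ / σ * u 0 ≤ 1 := by
      intro u hu
      have := hw u (mem_support_iff.1 hu)
      rw [weight, Set.mem_Iic] at this
      rw [← div_self hσ.ne']
      exact add_div_mul_le_div hσ (by linarith)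
    have hg : ∀ v ∈ (Phi z).support, (v 1 : ℝ) + ρ / σ * v 0 ≤ ρ / σ := by
      intro v hv
      have := hz v (mem_support_iff.1 hv)
      rw [weight, Set.mem_Iic] at this
      exact add_div_mul_le_div hσ (by linarith)
    have hs : -1 < ρ / σ := by rw [lt_div_iff₀ hσ]; linarith
    have hs1 : ρ / σ < 1 := by rw [div_lt_one hσ]; exact hlt
    have hsw : poisson (Phi z) (Phi w) = pderiv 1 (Phi w) * pderiv 0 (Phi z)
        - pderiv 0 (Phi w) * pderiv 1 (Phi z) := by rw [poisson]; ring
    obtain ⟨h1, h2⟩ := support_of_jacobian_eq_one (a := 1) (b := 0) (by decide) hs hs1 hf hg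
      fun s hs' hf' hg' m hm => by
        rw [← hsw]
        refine hP s 1 (by linarith) (fun v hv => ?_) (fun u hu => ?_) m ?_
        · have := hg' v (mem_support_iff.2 hv)
          rw [weight, Set.mem_Iic]; linarith
        · have := hf' u (mem_support_iff.2 hu)
          rw [weight, Set.mem_Iic]; linarith
        · rw [weight]; linarith
    exact eq_top_of_support (by decide) hwS' hzS' (coeff_mul_coeff_eq_one (by decide) hs1 hg
      (by rw [← hsw, hc, coeff_zero_one])) h1 h2
  · subst heq
    have hρ : 0 < ρ := by linarith
    have hsupp : ∀ f ∈ weightIn K ρ ρ (Set.Iic ρ), ∀ u ∈ f.support, u 0 + u 1 ≤ 1 := by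
      intro f hf u hu
      have := hf u (mem_support_iff.1 hu)
      rw [weight, Set.mem_Iic, ← mul_add, mul_le_iff_le_one_right hρ] at this
      exact_mod_cast this
    rw [coeff_zero_poisson, coeff_zero_one] at hc
    exact eq_top_of_linear hzS' hwS' hc (hsupp _ hz) (hsupp _ hw)
  · have hρ : 0 < ρ := by linarith
    have hf : ∀ u ∈ (Phi z).support, (u 0 : ℝ) + σ / ρ * u 1 ≤ 1 := by
      intro u hu
      have := hz u (mem_support_iff.1 hu)
      rw [weight, Set.mem_Iic] at this
      rw [← div_self hρ.ne']
      exact add_div_mul_le_div hρ (by linarith)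
    have hg : ∀ v ∈ (Phi w).support, (v 0 : ℝ) + σ / ρ * v 1 ≤ σ / ρ := by
      intro v hv
      have := hw v (mem_support_iff.1 hv)
      rw [weight, Set.mem_Iic] at this
      exact add_div_mul_le_div hρ (by linarith)
    have hs : -1 < σ / ρ := by rw [lt_div_iff₀ hρ]; linarith
    have hs1 : σ / ρ < 1 := by rw [div_lt_one hρ]; exact hlt
    obtain ⟨h1, h2⟩ := support_of_jacobian_eq_one (a := 0) (b := 1) (by decide) hs hs1 hf hg
      fun s hs' hf' hg' m hm => by
        refine hP 1 s (by linarith) (fun u hu => ?_) (fun v hv => ?_) m ?_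
        · have := hf' u (mem_support_iff.2 hu)
          rw [weight, Set.mem_Iic]; linarith
        · have := hg' v (mem_support_iff.2 hv)
          rw [weight, Set.mem_Iic]; linarith
        · rw [weight]; linarith
    exact eq_top_of_support (by decide) hzS' hwS' (coeff_mul_coeff_eq_one (by decide) hs1 hg
      (hc.trans coeff_zero_one)) h1 h2

end

section

variable {K : Type*} [Field K] {ρ σ : ℝ} {f g : MvPolynomial (Fin 2) K} {z w : WeylA1 K}

theorem polyDegree_mem_image (hf : f ≠ 0) :
    polyDegree ρ σ f ∈ weight ρ σ '' (f.support : Set (Fin 2 →₀ ℕ)) :=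
  Set.Nonempty.csSup_mem
    ((Finset.coe_nonempty.2 (support_nonempty.2 hf)).image _) (f.support.finite_toSet.image _)

theorem mem_weightIn_polyDegree (f : MvPolynomial (Fin 2) K) :
    f ∈ weightIn K ρ σ (Set.Iic (polyDegree ρ σ f)) := fun _ hm =>
  Set.mem_Iic.2 <| le_csSup (f.support.finite_toSet.image _).bddAbove
    (Set.mem_image_of_mem _ (Finset.mem_coe.2 (mem_support_iff.2 hm)))

open Classical in
theorem coeff_polyLeading (m : Fin 2 →₀ ℕ) :
    coeff m (polyLeading ρ σ f) = if weight ρ σ m = polyDegree ρ σ f then coeff m f else 0 := by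
  rw [polyLeading, coeff_sum]
  simp only [coeff_monomial, Finset.sum_ite_eq', Finset.mem_filter, mem_support_iff]
  by_cases h : weight ρ σ m = polyDegree ρ σ f
  · by_cases h' : coeff m f = 0 <;> simp [h, h']
  · simp [h]

theorem polyLeading_mem_weightIn :
    polyLeading ρ σ f ∈ weightIn K ρ σ {polyDegree ρ σ f} := by
  intro m hm
  rw [coeff_polyLeading] at hm
  by_contra h
  exact hm (if_neg h)

theorem sub_polyLeading_mem_weightIn :
    f - polyLeading ρ σ f ∈ weightIn K ρ σ (Set.Iio (polyDegree ρ σ f)) := by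
  intro m hm
  rw [coeff_sub, coeff_polyLeading] at hm
  split_ifs at hm with h
  · exact absurd (sub_self _) hm
  · rw [sub_zero] at hm
    exact lt_of_le_of_ne (mem_weightIn_polyDegree f m hm) h

theorem polyLeading_ne_zero (hf : f ≠ 0) : polyLeading ρ σ f ≠ 0 := by
  obtain ⟨m, hm, h⟩ := polyDegree_mem_image (ρ := ρ) (σ := σ) hf
  intro h0
  have h1 := coeff_polyLeading (ρ := ρ) (σ := σ) (f := f) m
  rw [h0, coeff_zero, if_pos h] at h1
  exact mem_support_iff.1 (Finset.mem_coe.1 hm) h1.symm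

theorem polyDegree_lt {c : ℝ} (hf : f ≠ 0) (h : f ∈ weightIn K ρ σ (Set.Iio c)) :
    polyDegree ρ σ f < c := by
  obtain ⟨m, hm, h1⟩ := polyDegree_mem_image (ρ := ρ) (σ := σ) hf
  rw [← h1]
  exact h m (mem_support_iff.1 hm)

/-- The `(ρ,σ)`-degree of an element of `A₁`. -/
def degree (ρ σ : ℝ) (z : WeylA1 K) : ℝ := polyDegree ρ σ (Phi z)

theorem leading_mem : leading ρ σ z ∈ weightIn K ρ σ {degree ρ σ z} := polyLeading_mem_weightIn

theorem Phi_mem : Phi z ∈ weightIn K ρ σ (Set.Iic (degree ρ σ z)) := mem_weightIn_polyDegree _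

theorem Phi_sub_leading_mem :
    Phi z - leading ρ σ z ∈ weightIn K ρ σ (Set.Iio (degree ρ σ z)) :=
  sub_polyLeading_mem_weightIn

theorem Phi_pow_sub_mem (h : 0 < ρ + σ) (n : ℕ) :
    Phi (z ^ n) - leading ρ σ z ^ n ∈ weightIn K ρ σ (Set.Iio (n * degree ρ σ z)) := by
  induction n with
  | zero => simp [Phi_one]
  | succ n ih =>
    have hpow := pow_mem_weightIn (leading_mem (ρ := ρ) (σ := σ) (z := z)) n
    have h1 : Phi (z ^ n) ∈ weightIn K ρ σ (Set.Iic (n * degree ρ σ z)) := by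
      have := add_mem (weightIn_mono Set.Iio_subset_Iic_self ih)
        (weightIn_mono (J := Set.Iic (n * degree ρ σ z)) (by simp) hpow)
      rwa [sub_add_cancel] at this
    have h2 := Phi_mul_sub_mem h h1 (Phi_mem (z := z))
    have h3 : (Phi (z ^ n) - leading ρ σ z ^ n) * Phi z
        ∈ weightIn K ρ σ (Set.Iio (n * degree ρ σ z + degree ρ σ z)) :=
      mul_mem_weightIn ih Phi_mem fun x hx y hy =>
        Set.mem_Iio.2 <| add_lt_add_of_lt_of_le hx hy
    have h4 : leading ρ σ z ^ n * (Phi z - leading ρ σ z)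
        ∈ weightIn K ρ σ (Set.Iio (n * degree ρ σ z + degree ρ σ z)) :=
      mul_mem_weightIn hpow Phi_sub_leading_mem fun x hx y hy =>
        Set.mem_Iio.2 <| add_lt_add_of_le_of_lt (le_of_eq hx) hy
    have h5 := add_mem (add_mem h2 h3) h4
    rw [Nat.cast_succ, add_one_mul, pow_succ, pow_succ]
    convert h5 using 1
    ring

theorem poisson_sub_poisson_leading_mem :
    poisson (Phi z) (Phi w) - poisson (leading ρ σ z) (leading ρ σ w)
      ∈ weightIn K ρ σ (Set.Iio (degree ρ σ z + degree ρ σ w - (ρ + σ))) := by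
  have h1 : poisson (Phi z - leading ρ σ z) (Phi w)
      ∈ weightIn K ρ σ (Set.Iio (degree ρ σ z + degree ρ σ w - (ρ + σ))) :=
    poisson_mem_weightIn Phi_sub_leading_mem Phi_mem fun x hx y hy =>
      Set.mem_Iio.2 <| sub_lt_sub_right (add_lt_add_of_lt_of_le hx hy) _
  have h2 : poisson (leading ρ σ z) (Phi w - leading ρ σ w)
      ∈ weightIn K ρ σ (Set.Iio (degree ρ σ z + degree ρ σ w - (ρ + σ))) :=
    poisson_mem_weightIn leading_mem Phi_sub_leading_mem fun x hx y hy =>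
      Set.mem_Iio.2 <| sub_lt_sub_right (add_lt_add_of_le_of_lt (le_of_eq hx) hy) _
  convert add_mem h1 h2 using 1
  simp only [poisson, map_sub]
  ring

theorem one_sub_poisson_leading_mem (h : 0 < ρ + σ) (hzw : z * w - w * z = 1) :
    1 - poisson (leading ρ σ z) (leading ρ σ w)
      ∈ weightIn K ρ σ (Set.Iio (degree ρ σ z + degree ρ σ w - (ρ + σ))) := by
  have h1 := Phi_commutator_sub_poisson_mem h (Phi_mem (z := z)) (Phi_mem (z := w))
  rw [hzw, Phi_one] at h1
  have h2 := add_mem (weightIn_mono (Set.Iic_subset_Iio.2 (by linarith)) h1)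
    (poisson_sub_poisson_leading_mem (ρ := ρ) (σ := σ) (z := z) (w := w))
  rwa [sub_add_sub_cancel] at h2

theorem degree_eq_of_poisson_leading_ne_zero (h : 0 < ρ + σ) (hzw : z * w - w * z = 1)
    (hP : poisson (leading ρ σ z) (leading ρ σ w) ≠ 0) :
    degree ρ σ z = ρ ∧ degree ρ σ w = σ ∨ degree ρ σ z = σ ∧ degree ρ σ w = ρ := by
  have h1 := one_sub_poisson_leading_mem h hzw
  have h2 : poisson (leading ρ σ z) (leading ρ σ w)
      ∈ weightIn K ρ σ {degree ρ σ z + degree ρ σ w - (ρ + σ)} :=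
    poisson_mem_weightIn leading_mem leading_mem (by rintro x rfl y rfl; rfl)
  obtain ⟨m, hm⟩ := ne_zero_iff.1 hP
  have hmw : weight ρ σ m = _ := h2 m hm
  have h3 := coeff_eq_zero_of_mem_weightIn h1 (m := m) (by rw [hmw]; exact Set.self_notMem_Iio)
  rw [coeff_sub, sub_eq_zero] at h3
  have hm0 : m = 0 := by
    classical
    by_contra hne
    rw [coeff_one, if_neg (Ne.symm hne)] at h3
    exact hm h3.symm
  rw [hm0, coeff_zero_one, coeff_zero_poisson] at h3
  have hw0 : weight ρ σ (Finsupp.single 0 1) = ρ := by simp [weight]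
  have hw1 : weight ρ σ (Finsupp.single 1 1) = σ := by simp [weight]
  by_cases h4 : coeff (Finsupp.single 0 1) (leading ρ σ z)
      * coeff (Finsupp.single 1 1) (leading ρ σ w) = 0
  · have h5 : coeff (Finsupp.single 1 1) (leading ρ σ z)
        * coeff (Finsupp.single 0 1) (leading ρ σ w) ≠ 0 := by
      intro h5
      rw [h4, h5, sub_zero] at h3
      exact one_ne_zero h3
    have ha : weight ρ σ _ = _ := leading_mem _ (left_ne_zero_of_mul h5)
    have hb : weight ρ σ _ = _ := leading_mem _ (right_ne_zero_of_mul h5)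
    exact Or.inr ⟨by rw [← ha, hw1], by rw [← hb, hw0]⟩
  · have ha : weight ρ σ _ = _ := leading_mem _ (left_ne_zero_of_mul h4)
    have hb : weight ρ σ _ = _ := leading_mem _ (right_ne_zero_of_mul h4)
    exact Or.inl ⟨by rw [← ha, hw0], by rw [← hb, hw1]⟩

/-- A nonzero homogeneous polynomial in a homogeneous `f` of positive degree is a multiple of a
power of `f`. -/
theorem eq_smul_pow_of_mem_adjoin {d e : ℝ} (hf : f ∈ weightIn K ρ σ {d})
    (hg : g ∈ weightIn K ρ σ {e}) (hde : 0 < d + e) (hg0 : g ≠ 0) (hfg : g ∈ Algebra.adjoin K {f}) :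
    0 < d ∧ ∃ (n : ℕ) (c : K), e = n * d ∧ g = c • f ^ n := by
  classical
  rw [Algebra.adjoin_singleton_eq_range_aeval] at hfg
  obtain ⟨P, hP⟩ := hfg
  change Polynomial.aeval f P = g at hP
  rw [Polynomial.aeval_eq_sum_range] at hP
  obtain ⟨m, hm⟩ := ne_zero_iff.1 hg0
  have hme : weight ρ σ m = e := hg m hm
  have hm' := hm
  rw [← hP, coeff_sum] at hm'
  obtain ⟨n, hn, hne⟩ := Finset.exists_ne_zero_of_sum_ne_zero hm'
  have hmem : ∀ k : ℕ, P.coeff k • f ^ k ∈ weightIn K ρ σ {(k : ℝ) * d} := fun k =>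
    Submodule.smul_mem _ _ (pow_mem_weightIn hf k)
  have hen : e = n * d := by rw [← hme]; exact hmem n m hne
  have hd : 0 < d := by
    by_contra! hle
    have : (n : ℝ) * d ≤ 0 := mul_nonpos_of_nonneg_of_nonpos (Nat.cast_nonneg _) hle
    linarith
  refine ⟨hd, n, P.coeff n, hen, ?_⟩
  rw [← sub_eq_zero]
  by_contra hsub
  obtain ⟨m', hm'⟩ := ne_zero_iff.1 hsub
  have h1 : weight ρ σ m' = e :=
    (sub_mem hg (by rw [hen]; exact hmem n) : g - P.coeff n • f ^ n ∈ weightIn K ρ σ {e}) m' hm'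
  rw [← hP, ← Finset.add_sum_erase _ _ hn, add_sub_cancel_left, coeff_sum] at hm'
  obtain ⟨k, hk, hk'⟩ := Finset.exists_ne_zero_of_sum_ne_zero hm'
  have h2 : weight ρ σ m' = k * d := hmem k m' hk'
  have h3 : (k : ℝ) = n := mul_right_cancel₀ hd.ne' (by rw [← h2, h1, hen])
  exact Finset.ne_of_mem_erase hk (by exact_mod_cast h3)

theorem ne_zero_of_commutator_eq_one (hzw : z * w - w * z = 1) : Phi w ≠ 0 := by
  intro h
  rw [LinearEquiv.map_eq_zero_iff] at h
  rw [h, mul_zero, zero_mul, sub_zero] at hzw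
  have h1 := Phi_one (K := K)
  rw [← hzw, map_zero] at h1
  exact zero_ne_one h1

/-- If the leading components of `z` and `w` commute, then a multiple of a power of `z` can be
subtracted from `w` so that the degree drops. -/
theorem exists_degree_lt (h : 0 < ρ + σ) (hzw : z * w - w * z = 1)
    (hC : poissonCentralizer (leading ρ σ z) =
      (Algebra.adjoin K {leading ρ σ z} : Set (MvPolynomial (Fin 2) K)))
    (hP : poisson (leading ρ σ z) (leading ρ σ w) = 0) :
    0 < degree ρ σ z ∧ ∃ (n : ℕ) (c : K), degree ρ σ w = n * degree ρ σ z ∧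
      z * (w - c • z ^ n) - (w - c • z ^ n) * z = 1 ∧
      degree ρ σ (w - c • z ^ n) < degree ρ σ w := by
  have h1 := one_sub_poisson_leading_mem h hzw
  rw [hP, sub_zero] at h1
  have h2 : weight ρ σ 0 < degree ρ σ z + degree ρ σ w - (ρ + σ) :=
    h1 0 (by rw [coeff_zero_one]; exact one_ne_zero)
  have hw0 : weight ρ σ 0 = 0 := by simp [weight]
  have hmem : leading ρ σ w ∈ (Algebra.adjoin K {leading ρ σ z} : Set (MvPolynomial (Fin 2) K)) :=
    hC ▸ hP
  obtain ⟨hd, n, c, hn, hc⟩ := eq_smul_pow_of_mem_adjoin leading_mem leading_mem (by linarith)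
    (polyLeading_ne_zero (ne_zero_of_commutator_eq_one hzw)) hmem
  have hcomm : z * (w - c • z ^ n) - (w - c • z ^ n) * z = 1 := by
    rw [mul_sub, sub_mul, mul_smul_comm, smul_mul_assoc, ← pow_succ, ← pow_succ',
      sub_sub_sub_cancel_right, hzw]
  refine ⟨hd, n, c, hn, hcomm, polyDegree_lt (ne_zero_of_commutator_eq_one hcomm) ?_⟩
  have hpow := Phi_pow_sub_mem (z := z) h n
  rw [← hn] at hpow
  have h3 := sub_mem (Phi_sub_leading_mem (ρ := ρ) (σ := σ) (z := w))
    (Submodule.smul_mem _ c hpow)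
  rw [hc, smul_sub, sub_sub_sub_cancel_right] at h3
  rwa [map_sub, map_smul]

theorem mul_neg_one_smul_sub (K : Type*) {A : Type*} [Field K] [Ring A] [Algebra K A] (a b : A) :
    b * ((-1 : K) • a) - (-1 : K) • a * b = a * b - b * a := by
  rw [neg_one_smul, mul_neg, neg_mul, neg_sub_neg]

theorem eq_top_of_poisson_leading_ne_zero [CharZero K] {S : Subalgebra K (WeylA1 K)}
    (h : 0 < ρ + σ) (hzw : z * w - w * z = 1)
    (hP : poisson (leading ρ σ z) (leading ρ σ w) ≠ 0) (hz : z ∈ S) (hw : w ∈ S) : S = ⊤ := by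
  have hz' := Phi_mem (ρ := ρ) (σ := σ) (z := z)
  have hw' := Phi_mem (ρ := ρ) (σ := σ) (z := w)
  rcases degree_eq_of_poisson_leading_ne_zero h hzw hP with ⟨h1, h2⟩ | ⟨h1, h2⟩
  · rw [h1] at hz'
    rw [h2] at hw'
    exact eq_top_of_commutator_eq_one h hzw hz' hw' hz hw
  · rw [h1] at hz'
    rw [h2] at hw'
    have hcomm : w * ((-1 : K) • z) - (-1 : K) • z * w = 1 :=
      (mul_neg_one_smul_sub K z w).trans hzw
    exact eq_top_of_commutator_eq_one h hcomm hw'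
      (by rw [map_smul]; exact Submodule.smul_mem _ _ hz') hw (S.smul_mem hz _)

theorem eq_top_of_degree_lt [CharZero K] {S : Subalgebra K (WeylA1 K)} (h : 0 < ρ + σ)
    (hC : poissonCentralizer (leading ρ σ z) =
      (Algebra.adjoin K {leading ρ σ z} : Set (MvPolynomial (Fin 2) K)))
    (hz : z ∈ S) (hd : 0 < degree ρ σ z) (N : ℕ) (hzw : z * w - w * z = 1) (hw : w ∈ S)
    (hN : degree ρ σ w < N * degree ρ σ z) : S = ⊤ := by
  induction N generalizing w with
  | zero =>
    by_cases hP : poisson (leading ρ σ z) (leading ρ σ w) = 0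
    · obtain ⟨-, n, c, hn, -⟩ := exists_degree_lt h hzw hC hP
      have : (0 : ℝ) ≤ n * degree ρ σ z := by positivity
      rw [Nat.cast_zero, zero_mul] at hN
      linarith
    · exact eq_top_of_poisson_leading_ne_zero h hzw hP hz hw
  | succ N ih =>
    by_cases hP : poisson (leading ρ σ z) (leading ρ σ w) = 0
    · obtain ⟨-, n, c, hn, hcomm, hlt⟩ := exists_degree_lt h hzw hC hP
      refine ih hcomm (S.sub_mem hw (S.smul_mem (S.pow_mem hz n) c)) (hlt.trans_le ?_)
      rw [hn, mul_lt_mul_iff_left₀ hd] at hN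
      rw [hn]
      have : n ≤ N := Nat.lt_succ_iff.1 (by exact_mod_cast hN)
      gcongr
    · exact eq_top_of_poisson_leading_ne_zero h hzw hP hz hw

end

end

end WeylA1

theorem theorem56 {K : Type*} [Field K] [CharZero K] (z : WeylA1 K) (hz : z ≠ 0)
    (ρ σ : ℝ) (hρσ : 0 < ρ + σ) (f : MvPolynomial (Fin 2) K) (hf : f = WeylA1.leading ρ σ z)
    (hC : WeylA1.poissonCentralizer f =
      (Algebra.adjoin K {f} : Set (MvPolynomial (Fin 2) K)))
    (w : WeylA1 K) (hzw : z * w - w * z = 1) :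
    Algebra.adjoin K {z, w} = (⊤ : Subalgebra K (WeylA1 K)) := by
  subst hf
  have hzS : z ∈ Algebra.adjoin K {z, w} := Algebra.subset_adjoin (by simp)
  have hwS : w ∈ Algebra.adjoin K {z, w} := Algebra.subset_adjoin (by simp)
  by_cases hP : WeylA1.poisson (WeylA1.leading ρ σ z) (WeylA1.leading ρ σ w) = 0
  · obtain ⟨hd, -⟩ := WeylA1.exists_degree_lt hρσ hzw hC hP
    obtain ⟨N, hN⟩ := exists_nat_gt (WeylA1.degree ρ σ w / WeylA1.degree ρ σ z)
    exact WeylA1.eq_top_of_degree_lt hρσ hC hzS hd N hzw hwS ((div_lt_iff₀ hd).1 hN)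
  · exact WeylA1.eq_top_of_poisson_leading_ne_zero hρσ hzw hP hzS hwS
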